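/- Let $A$ be a ring (associative, with unit, not necessarily commutative); "module" means unital right module. Let $M$ be an $A$-module that is a generator, i.e. there is an $A$-linear epimorphism $M^{n}\twoheadrightarrow A$ for some $n$. Let $B=\operatorname{End}_A(M)$, let $M^{*}=\operatorname{Hom}_A(M,A)$, and let $\underline{\operatorname{End}}_A(M)$ be the stable endomorphism ring of $M$, that is, the quotient of $B$ by the two-sided ideal that is the image of the norm map $M\otimes_A M^{*}\to B$, $m\otimes\lambda\mapsto\bigl(m'\mapsto m\cdot\lambda(m')\bigr)$. View $\underline{\operatorname{End}}_A(M)$ as a right $B$-module, and let $$g=\operatorname{grade}_{B}\underline{\operatorname{End}}_A(M)=\inf\{i\ge 0\mid \operatorname{Ext}^{i}_{B}(\underline{\operatorname{End}}_A(M),B)\neq 0\}\in\mathbb{N}\cup\{\infty\}$$ be its grade, where $\inf\emptyset=\infty$. Then $$g=1+\inf\{i\ge 1\mid \operatorname{Ext}^{i}_{A}(M,M)\neq 0\}\ge 2.$$ Moreover, if $g$ is finite, then there is an isomorphism of abelian groups $$\operatorname{Ext}^{g}_{B}(\underline{\operatorname{End}}_A(M),B)\cong\operatorname{Ext}^{g-1}_{A}(M,M).$$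 -/

import Mathlib

open CategoryTheory

universe u

namespace RightModule

/-! Right modules over a ring `A` are modules over `Aᵐᵒᵖ`: the product `m · a` is
`MulOpposite.op a • m`. -/

/-- The Ext group of right `A`-modules `X`, `Y`, computed in the abelian category of
right `A`-modules. -/
noncomputable abbrev ExtGroup (A : Type u) [Ring A] (X Y : Type u)
    [AddCommGroup X] [Module Aᵐᵒᵖ X] [AddCommGroup Y] [Module Aᵐᵒᵖ Y] (i : ℕ) : Type u :=
  Abelian.Ext.{u} (ModuleCat.of.{u} Aᵐᵒᵖ X) (ModuleCat.of.{u} Aᵐᵒᵖ Y) i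

/-- A right `A`-module `M` is a generator if some finite power of `M` maps onto `A`. -/
def IsGenerator (A : Type u) [Ring A] (M : Type u) [AddCommGroup M] [Module Aᵐᵒᵖ M] : Prop :=
  ∃ (n : ℕ) (p : (Fin n → M) →ₗ[Aᵐᵒᵖ] A), Function.Surjective p

/-- The grade of a right `A`-module `X`: the infimum of the `i ≥ 0` with nonzero
`Ext^i_A(X, A)`; it is `⊤` if there is no such `i`. -/
noncomputable def grade (A : Type u) [Ring A] (X : Type u) [AddCommGroup X]
    [Module Aᵐᵒᵖ X] : ℕ∞ :=
  ⨅ (i : ℕ) (_ : Nontrivial (ExtGroup A X A i)), (i : ℕ∞)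

section StableEnd

variable (A : Type u) [Ring A] (M : Type u) [AddCommGroup M] [Module Aᵐᵒᵖ M]

/-- The endomorphism ring of the right `A`-module `M`; the product is composition. -/
abbrev EndRing : Type u := Module.End Aᵐᵒᵖ M

variable {A M}

/-- The endomorphism `m' ↦ m · l m'` attached to `m` in `M` and `l` in `M* = Hom_A(M, A)`. -/
def normEnd (m : M) (l : M →ₗ[Aᵐᵒᵖ] A) : EndRing A M where
  toFun m' := MulOpposite.op (l m') • m
  map_add' x y := by simp [add_smul]
  map_smul' a x := by
    rw [map_smul, RingHom.id_apply, ← mul_smul]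
    rfl

theorem mul_normEnd (b : EndRing A M) (m : M) (l : M →ₗ[Aᵐᵒᵖ] A) :
    b * normEnd m l = normEnd (b m) l := by
  ext x
  exact map_smul b _ _

theorem normEnd_mul (b : EndRing A M) (m : M) (l : M →ₗ[Aᵐᵒᵖ] A) :
    normEnd m l * b = normEnd m (l ∘ₗ b) := rfl

variable (A M)

/-- The image of the norm map `M ⊗_A M* → End_A(M)`, that is, the additive group of all
finite sums of endomorphisms `m' ↦ m · l m'`. -/
def normImage : AddSubgroup (EndRing A M) :=
  AddSubgroup.closure {b | ∃ (m : M) (l : M →ₗ[Aᵐᵒᵖ] A), b = normEnd m l}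

variable {A M}

theorem mul_mem_normImage (b : EndRing A M) {c : EndRing A M} (hc : c ∈ normImage A M) :
    b * c ∈ normImage A M := by
  induction hc using AddSubgroup.closure_induction with
  | mem x hx =>
    obtain ⟨m, l, rfl⟩ := hx
    exact AddSubgroup.subset_closure ⟨b m, l, mul_normEnd b m l⟩
  | zero => rw [mul_zero]; exact zero_mem _
  | add x y _ _ hx hy => rw [mul_add]; exact add_mem hx hy
  | neg x _ hx => rw [mul_neg]; exact neg_mem hx

theorem normImage_mul_mem {c : EndRing A M} (b : EndRing A M) (hc : c ∈ normImage A M) :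
    c * b ∈ normImage A M := by
  induction hc using AddSubgroup.closure_induction with
  | mem x hx =>
    obtain ⟨m, l, rfl⟩ := hx
    exact AddSubgroup.subset_closure ⟨m, l ∘ₗ b, normEnd_mul b m l⟩
  | zero => rw [zero_mul]; exact zero_mem _
  | add x y _ _ hx hy => rw [add_mul]; exact add_mem hx hy
  | neg x _ hx => rw [neg_mul]; exact neg_mem hx

variable (A M)

/-- The image of the norm map as a two-sided ideal of `End_A(M)`. -/
def normIdeal : TwoSidedIdeal (EndRing A M) :=
  TwoSidedIdeal.mk' (normImage A M : Set (EndRing A M)) (zero_mem _)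
    (fun hx hy => add_mem hx hy) (fun hx => neg_mem hx)
    (fun {x _} hy => mul_mem_normImage x hy) (fun {_ y} hx => normImage_mul_mem y hx)

/-- The stable endomorphism ring of `M`: the cokernel of the norm map. -/
def StableEnd : Type u := (normIdeal A M).ringCon.Quotient

instance : Ring (StableEnd A M) :=
  inferInstanceAs (Ring (normIdeal A M).ringCon.Quotient)

/-- The canonical surjection from the endomorphism ring to the stable endomorphism ring. -/
def StableEnd.mk : EndRing A M →+* StableEnd A M := (normIdeal A M).ringCon.mk'

/-- The stable endomorphism ring as a right module over `End_A(M)`: the product `c · b` is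
the product of `c` with the class of `b`. -/
instance : Module (EndRing A M)ᵐᵒᵖ (StableEnd A M) :=
  Module.compHom (StableEnd A M) (StableEnd.mk A M).op

end StableEnd

end RightModule

/-! Write `B` for the endomorphism ring, `E` for the stable one, and `H = Hom_A(M, -)`, so that `B =
H M`. The norm image kills `E`, and since `M` is a generator it moves every element of `M`. Hence no
nonzero map `E → H N` exists (`HomFrom.linearMap_eq_zero`), and `H` preserves injectives
(`HomFrom.injective`), so `Ext_B(E, H J)` vanishes in all degrees for injective `J`. Embed `N` in an
injective `J` with cokernel `N'`, and let `L ⊆ H N'` be the maps that lift to `J`. Then `Ext^i_B(E,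
L) ≅ Ext^{i+1}_B(E, H N)`, and `H N' / L ≅ Ext¹_A(M, N)` is killed by the norm image, so `Hom_B(E, H
N' / L)` is `H N' / L` itself. This gives `Ext²_B(E, H N) ≅ Ext¹_A(M, N)`, with vanishing below
degree 2. If `Ext¹_A(M, N) = 0` then `L = H N'`, and dimension shifting on both sides gives
`ext_stableEnd_homFrom` by induction; the theorem is the case `N = M`. -/

namespace RightModule

/-! ### The functor `Hom_A(M, -)` for a generator `M` -/

section HomFrom

variable (A : Type u) [Ring A] (M N : Type u) [AddCommGroup M] [Module Aᵐᵒᵖ M]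
  [AddCommGroup N] [Module Aᵐᵒᵖ N]

/-- The additive group `Hom_A(M, N)`, regarded as a right module over `End_A(M)`. -/
def HomFrom : Type u := M →ₗ[Aᵐᵒᵖ] N

instance : AddCommGroup (HomFrom A M N) := inferInstanceAs (AddCommGroup (M →ₗ[Aᵐᵒᵖ] N))

instance : FunLike (HomFrom A M N) M N := inferInstanceAs (FunLike (M →ₗ[Aᵐᵒᵖ] N) M N)

instance : LinearMapClass (HomFrom A M N) Aᵐᵒᵖ M N :=
  inferInstanceAs (LinearMapClass (M →ₗ[Aᵐᵒᵖ] N) Aᵐᵒᵖ M N)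

variable {A M N}

@[ext]
theorem HomFrom.ext {f g : HomFrom A M N} (h : ∀ m, f m = g m) : f = g := DFunLike.ext f g h

@[simp]
theorem HomFrom.add_apply (f g : HomFrom A M N) (m : M) : (f + g) m = f m + g m := rfl

@[simp]
theorem HomFrom.zero_apply (m : M) : (0 : HomFrom A M N) m = 0 := rfl

/-- Precomposition makes `Hom_A(M, N)` a right `End_A(M)`-module. -/
instance : Module (EndRing A M)ᵐᵒᵖ (HomFrom A M N) where
  smul b f := (show M →ₗ[Aᵐᵒᵖ] N from f) ∘ₗ b.unop
  one_smul _ := rfl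
  mul_smul _ _ _ := rfl
  smul_zero _ := rfl
  smul_add _ _ _ := rfl
  add_smul b c f := by ext m; exact map_add f _ _
  zero_smul f := by ext m; exact map_zero f

variable (A M) in
/-- Postcomposition with an `A`-linear map, as a map of right `End_A(M)`-modules. -/
def HomFrom.map {N' : Type u} [AddCommGroup N'] [Module Aᵐᵒᵖ N'] (f : N →ₗ[Aᵐᵒᵖ] N') :
    HomFrom A M N →ₗ[(EndRing A M)ᵐᵒᵖ] HomFrom A M N' where
  toFun h := f ∘ₗ (show M →ₗ[Aᵐᵒᵖ] N from h)
  map_add' g h := by ext m; exact map_add f _ _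
  map_smul' _ _ := rfl

variable (A M) in
/-- `End_A(M)` as a right module over itself is `Hom_A(M, M)`. -/
def HomFrom.endEquiv : EndRing A M ≃ₗ[(EndRing A M)ᵐᵒᵖ] HomFrom A M M where
  toFun b := b
  invFun b := b
  map_add' _ _ := rfl
  map_smul' _ _ := rfl

@[simp]
theorem normEnd_apply (m : M) (l : M →ₗ[Aᵐᵒᵖ] A) (x : M) :
    normEnd m l x = MulOpposite.op (l x) • m := rfl

theorem normEnd_zero (l : M →ₗ[Aᵐᵒᵖ] A) : normEnd (0 : M) l = 0 := by
  ext; simp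

theorem normEnd_add (m m' : M) (l : M →ₗ[Aᵐᵒᵖ] A) :
    normEnd (m + m') l = normEnd m l + normEnd m' l := by
  ext; simp

theorem IsGenerator.exists_sum_eq_one (hM : IsGenerator A M) :
    ∃ (n : ℕ) (l : Fin n → M →ₗ[Aᵐᵒᵖ] A) (x : Fin n → M), ∑ k, l k (x k) = 1 := by
  obtain ⟨n, p, hp⟩ := hM
  obtain ⟨x, hx⟩ := hp 1
  refine ⟨n, fun k => p ∘ₗ LinearMap.single Aᵐᵒᵖ (fun _ => M) k, x, ?_⟩
  rw [← hx]
  conv_rhs => rw [← Finset.univ_sum_single x, map_sum]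
  rfl

/-- This is where the generator hypothesis acts: the norm image applied to `M` gives all of `M`. -/
theorem sum_normEnd_apply {n : ℕ} {l : Fin n → M →ₗ[Aᵐᵒᵖ] A} {x : Fin n → M}
    (h : ∑ k, l k (x k) = 1) (m : M) : ∑ k, normEnd m (l k) (x k) = m := by
  simp only [normEnd_apply]
  rw [← Finset.sum_smul, ← Finset.op_sum, h, MulOpposite.op_one, one_smul]

/-- A right `End_A(M)`-module annihilated by the image of the norm map has no nonzero map
to a module of the form `Hom_A(M, N)`. -/
theorem HomFrom.linearMap_eq_zero (hM : IsGenerator A M) {X : Type u} [AddCommGroup X]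
    [Module (EndRing A M)ᵐᵒᵖ X]
    (hX : ∀ (m : M) (l : M →ₗ[Aᵐᵒᵖ] A) (x : X), MulOpposite.op (normEnd m l) • x = 0)
    (f : X →ₗ[(EndRing A M)ᵐᵒᵖ] HomFrom A M N) : f = 0 := by
  obtain ⟨n, l, y, h⟩ := hM.exists_sum_eq_one
  ext x m
  rw [← sum_normEnd_apply h m, map_sum, map_sum]
  refine Finset.sum_congr rfl fun k _ => ?_
  change (MulOpposite.op (normEnd m (l k)) • f x) (y k) = 0
  rw [← map_smul, hX, map_zero, HomFrom.zero_apply]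

/-- `Hom_A(M, -)` preserves injective modules when `M` is a generator. -/
theorem HomFrom.injective (hM : IsGenerator A M) [Module.Injective Aᵐᵒᵖ N] :
    Module.Injective (EndRing A M)ᵐᵒᵖ (HomFrom A M N) := by
  obtain ⟨n, l, y, h⟩ := hM.exists_sum_eq_one
  refine Module.Baer.injective fun I φ => ?_
  -- Baer's criterion for a right ideal `I` of `B`: the wanted `Ψ : M → N` must send `a m` to `φ a
  -- m`. `P` and `Φ` record the two sides; once `Φ` factors through the image of `P`, injectivity of
  -- `N` extends it to `M`.
  let P : (I →₀ M) →ₗ[Aᵐᵒᵖ] M := Finsupp.lsum ℕ fun a => a.1.unop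
  let Φ : (I →₀ M) →ₗ[Aᵐᵒᵖ] N := Finsupp.lsum ℕ fun a => (show M →ₗ[Aᵐᵒᵖ] N from φ a)
  let T (k : Fin n) : (I →₀ M) →+ I := Finsupp.liftAddHom fun a =>
    { toFun := fun m => MulOpposite.op (normEnd m (l k)) • a
      map_zero' := by rw [normEnd_zero, MulOpposite.op_zero, zero_smul]
      map_add' := fun m m' => by rw [normEnd_add, MulOpposite.op_add, add_smul] }
  have hT (k : Fin n) (e : I →₀ M) : (T k e : (EndRing A M)ᵐᵒᵖ) =
      MulOpposite.op (normEnd (P e) (l k)) := by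
    induction e using Finsupp.induction_linear with
    | zero => simp [normEnd_zero]
    | add e e' he he' => simp [he, he', normEnd_add]
    | single a m =>
      have h1 : T k (Finsupp.single a m) = MulOpposite.op (normEnd m (l k)) • a :=
        (Finsupp.liftAddHom_apply_single _ _ _)
      have h2 : P (Finsupp.single a m) = a.1.unop m := by simp [P]
      rw [h1, h2, ← mul_normEnd]
      rfl
  have hΦ (e : I →₀ M) : Φ e = ∑ k, φ (T k e) (y k) := by
    induction e using Finsupp.induction_linear with
    | zero => simp
    | add e e' he he' => simp [he, he', Finset.sum_add_distrib]
    | single a m =>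
      have h1 (k : Fin n) : T k (Finsupp.single a m) = MulOpposite.op (normEnd m (l k)) • a :=
        (Finsupp.liftAddHom_apply_single _ _ _)
      have h2 : Φ (Finsupp.single a m) = φ a m := Finsupp.lsum_single ℕ _ _ _
      rw [h2]
      conv_lhs => rw [← sum_normEnd_apply h m, map_sum]
      refine Finset.sum_congr rfl fun k _ => ?_
      rw [h1, map_smul]
      rfl
  -- `T k e` lies in `I` and depends only on `P e`, while `Φ e` is computed from the `T k e`.
  have hker : LinearMap.ker P ≤ LinearMap.ker Φ := fun e he => by
    rw [LinearMap.mem_ker] at he ⊢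
    rw [hΦ]
    refine Finset.sum_eq_zero fun k _ => ?_
    have : T k e = 0 := by
      apply Subtype.ext
      rw [hT, he, normEnd_zero]
      rfl
    rw [this, map_zero, HomFrom.zero_apply]
  obtain ⟨Ψ, hΨ⟩ := Module.Injective.out ((LinearMap.ker P).liftQ P le_rfl)
    (LinearMap.ker_eq_bot.mp (Submodule.ker_liftQ_eq_bot _ _ _ le_rfl))
    ((LinearMap.ker P).liftQ Φ hker)
  refine ⟨HomFrom.map A M Ψ ∘ₗ (HomFrom.endEquiv A M).toLinearMap ∘ₗ
    (MulOpposite.opLinearEquiv (EndRing A M)ᵐᵒᵖ).symm.toLinearMap, fun b hb => ?_⟩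
  ext m
  have := hΨ (Submodule.Quotient.mk (Finsupp.single ⟨b, hb⟩ m))
  have hP : P (Finsupp.single ⟨b, hb⟩ m) = b.unop m := Finsupp.lsum_single ℕ _ _ _
  simp only [Submodule.liftQ_apply, hP] at this
  exact this.trans (Finsupp.lsum_single ℕ _ _ _)

end HomFrom

end RightModule

/-! ### Connecting maps of Ext -/

section

open Abelian

universe w v w'

variable {C : Type w'} [Category.{v} C] [Abelian C] [HasExt.{w} C]

/-- If `Ext X S.X₂` vanishes in degrees `i` and `i + 1`, the connecting map of the short exact
sequence `S` is an isomorphism. -/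
theorem CategoryTheory.ShortComplex.ShortExact.nonempty_ext_addEquiv {S : ShortComplex C}
    (hS : S.ShortExact) (X : C) (i : ℕ) (h : Subsingleton (Ext.{w} X S.X₂ i))
    (h' : Subsingleton (Ext.{w} X S.X₂ (i + 1))) :
    Nonempty (Ext.{w} X S.X₃ i ≃+ Ext.{w} X S.X₁ (i + 1)) := by
  refine ⟨AddEquiv.ofBijective (hS.extClass.postcomp X rfl) ⟨?_, fun x => ?_⟩⟩
  · refine (injective_iff_map_eq_zero _).mpr fun x hx => ?_
    obtain ⟨y, rfl⟩ := Ext.covariant_sequence_exact₃ X hS x rfl hx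
    rw [Subsingleton.elim y 0, Ext.zero_comp]
  · exact Ext.covariant_sequence_exact₁ X hS x (Subsingleton.elim _ _) rfl

/-- If `Ext X S.X₂ 1` vanishes, then `Ext X S.X₁ 1` is the cokernel of
`(X ⟶ S.X₂) → (X ⟶ S.X₃)`. -/
theorem CategoryTheory.ShortComplex.ShortExact.exists_hom_to_ext_one {S : ShortComplex C}
    (hS : S.ShortExact) (X : C) (h : Subsingleton (Ext.{w} X S.X₂ 1)) :
    ∃ δ : (X ⟶ S.X₃) →+ Ext.{w} X S.X₁ 1, Function.Surjective δ ∧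
      ∀ f, δ f = 0 ↔ ∃ g : X ⟶ S.X₂, g ≫ S.g = f := by
  refine ⟨(hS.extClass.postcomp X (zero_add 1)).comp Ext.addEquiv₀.symm.toAddMonoidHom,
    fun x => ?_, fun f => ⟨fun hf => ?_, ?_⟩⟩
  · obtain ⟨y, hy⟩ := Ext.covariant_sequence_exact₁ X hS x (Subsingleton.elim _ _) (zero_add 1)
    exact ⟨Ext.addEquiv₀ y, by simpa using hy⟩
  · obtain ⟨y, hy⟩ := Ext.covariant_sequence_exact₃ X hS (Ext.mk₀ f) (zero_add 1) hf
    obtain ⟨g, rfl⟩ := (Ext.mk₀_bijective _ _).2 y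
    rw [Ext.mk₀_comp_mk₀] at hy
    exact ⟨g, (Ext.mk₀_bijective _ _).1 hy⟩
  · rintro ⟨g, rfl⟩
    change (Ext.mk₀ (g ≫ S.g)).comp hS.extClass (zero_add 1) = 0
    rw [← Ext.mk₀_comp_mk₀_assoc, hS.comp_extClass, Ext.comp_zero]

end

/-! ### Maps out of the stable endomorphism ring -/

namespace RightModule

variable {A : Type u} [Ring A] {M : Type u} [AddCommGroup M] [Module Aᵐᵒᵖ M]

/-- An endomorphism in the image of the norm map vanishes in the stable endomorphism ring. -/
theorem StableEnd.mk_normEnd (m : M) (l : M →ₗ[Aᵐᵒᵖ] A) :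
    StableEnd.mk A M (normEnd m l) = 0 := by
  have : normEnd m l ∈ normIdeal A M :=
    (TwoSidedIdeal.mem_mk' ..).mpr (AddSubgroup.subset_closure ⟨m, l, rfl⟩)
  exact Quotient.sound this

theorem StableEnd.op_smul (b : EndRing A M) (x : StableEnd A M) :
    MulOpposite.op b • x = x * StableEnd.mk A M b := rfl

theorem StableEnd.mk_surjective : Function.Surjective (StableEnd.mk A M) :=
  Quotient.mk_surjective

theorem StableEnd.op_normEnd_smul (m : M) (l : M →ₗ[Aᵐᵒᵖ] A) (x : StableEnd A M) :
    MulOpposite.op (normEnd m l) • x = 0 := by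
  rw [op_smul, mk_normEnd, mul_zero]

theorem StableEnd.mk_eq_zero_iff (b : EndRing A M) :
    StableEnd.mk A M b = 0 ↔ b ∈ normImage A M := by
  rw [show StableEnd.mk A M b = 0 ↔ b ∈ normIdeal A M from ?_]
  · exact TwoSidedIdeal.mem_mk' ..
  · exact (normIdeal A M).ringCon.eq

/-- Homomorphisms from the stable endomorphism ring to a module annihilated by the image of the
norm map correspond to elements, by evaluation at `1`. -/
noncomputable def StableEnd.homEquiv (Q : Type u) [AddCommGroup Q] [Module (EndRing A M)ᵐᵒᵖ Q]
    (hQ : ∀ (m : M) (l : M →ₗ[Aᵐᵒᵖ] A) (q : Q), MulOpposite.op (normEnd m l) • q = 0) :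
    (StableEnd A M →ₗ[(EndRing A M)ᵐᵒᵖ] Q) ≃+ Q :=
  AddEquiv.ofBijective
    (AddMonoidHom.mk' (fun f : StableEnd A M →ₗ[(EndRing A M)ᵐᵒᵖ] Q => f 1) fun _ _ => rfl) <| by
  have hQ' (b : EndRing A M) (hb : b ∈ normImage A M) (q : Q) : MulOpposite.op b • q = 0 := by
    induction hb using AddSubgroup.closure_induction with
    | mem x hx => obtain ⟨m, l, rfl⟩ := hx; exact hQ m l q
    | zero => exact zero_smul _ q
    | add x y _ _ hx hy => rw [MulOpposite.op_add, add_smul, hx, hy, add_zero]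
    | neg x _ hx => rw [MulOpposite.op_neg, neg_smul, hx, neg_zero]
  constructor
  · intro f g hfg
    ext x
    obtain ⟨b, rfl⟩ := StableEnd.mk_surjective x
    have hb : StableEnd.mk A M b = MulOpposite.op b • 1 := (one_mul _).symm
    rw [hb, map_smul, map_smul]
    exact congrArg _ hfg
  · intro q
    let p : (EndRing A M) →ₗ[(EndRing A M)ᵐᵒᵖ] StableEnd A M :=
      { toFun := StableEnd.mk A M
        map_add' := map_add _
        map_smul' := fun b x => map_mul (StableEnd.mk A M) x b.unop }
    let φ : EndRing A M →ₗ[(EndRing A M)ᵐᵒᵖ] Q :=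
      { toFun := fun b => MulOpposite.op b • q
        map_add' := fun b c => by rw [MulOpposite.op_add, add_smul]
        map_smul' := fun b x => mul_smul b (MulOpposite.op x) q }
    have hker : LinearMap.ker p ≤ LinearMap.ker φ := fun b hb =>
      hQ' b ((StableEnd.mk_eq_zero_iff b).mp hb) q
    refine ⟨(LinearMap.ker p).liftQ φ hker ∘ₗ
      (p.quotKerEquivOfSurjective StableEnd.mk_surjective).symm.toLinearMap, ?_⟩
    have h1 : (p.quotKerEquivOfSurjective StableEnd.mk_surjective).symm 1 =
        Submodule.Quotient.mk 1 := by
      rw [LinearEquiv.symm_apply_eq]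
      exact (map_one (StableEnd.mk A M)).symm
    change (LinearMap.ker p).liftQ φ hker
      ((p.quotKerEquivOfSurjective StableEnd.mk_surjective).symm 1) = q
    rw [h1]
    exact one_smul _ q

end RightModule

/-! ### Dimension shifting over `A` and over `B` -/

namespace RightModule

variable {A : Type u} [Ring A] {M : Type u} [AddCommGroup M] [Module Aᵐᵒᵖ M]

theorem subsingleton_ext_zero {R : Type u} [Ring R] {X Y : Type u} [AddCommGroup X] [Module R X]
    [AddCommGroup Y] [Module R Y] (h : ∀ f : X →ₗ[R] Y, f = 0) :
    Subsingleton (Abelian.Ext.{u} (ModuleCat.of.{u} R X) (ModuleCat.of.{u} R Y) 0) := by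
  refine Abelian.Ext.homEquiv₀.subsingleton_congr.mpr ⟨fun f g => ?_⟩
  ext1
  rw [h f.hom, h g.hom]

theorem subsingleton_ext_zero_homFrom (hM : IsGenerator A M) (N : Type u) [AddCommGroup N]
    [Module Aᵐᵒᵖ N] :
    Subsingleton (ExtGroup (EndRing A M) (StableEnd A M) (HomFrom A M N) 0) :=
  subsingleton_ext_zero (HomFrom.linearMap_eq_zero hM StableEnd.op_normEnd_smul)

theorem subsingleton_ext_homFrom_of_injective (hM : IsGenerator A M) (J : Type u) [AddCommGroup J]
    [Module Aᵐᵒᵖ J] [Module.Injective Aᵐᵒᵖ J] (i : ℕ) :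
    Subsingleton (ExtGroup (EndRing A M) (StableEnd A M) (HomFrom A M J) i) := by
  cases i with
  | zero => exact subsingleton_ext_zero_homFrom hM J
  | succ i =>
    have := HomFrom.injective (N := J) hM
    have := Module.injective_object_of_injective_module (EndRing A M)ᵐᵒᵖ (HomFrom A M J)
    exact Abelian.Ext.subsingleton_of_injective _ _ i

section Cosyzygy

variable {S : ShortComplex (ModuleCat.{u} Aᵐᵒᵖ)}

variable (M S) in
/-- The submodule of `Hom_A(M, S.X₃)` of the maps that lift to `S.X₂`. -/
abbrev liftable : Submodule (EndRing A M)ᵐᵒᵖ (HomFrom A M S.X₃) :=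
  LinearMap.range (HomFrom.map A M S.g.hom)

/-- Composing `f` with `normEnd m l` factors through `l : M → A`, and a map from the free module `A`
lifts: choose a preimage `y` of `f m`. -/
theorem normEnd_smul_mem_liftable (hS : S.ShortExact) (m : M) (l : M →ₗ[Aᵐᵒᵖ] A)
    (f : HomFrom A M S.X₃) : MulOpposite.op (normEnd m l) • f ∈ liftable M S := by
  obtain ⟨y, hy⟩ := hS.moduleCat_surjective_g (f m)
  let e : M →ₗ[Aᵐᵒᵖ] S.X₂ :=
    { toFun := fun x => MulOpposite.op (l x) • y
      map_add' := fun x x' => by rw [map_add, MulOpposite.op_add, add_smul]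
      map_smul' := fun a x => by
        rw [map_smul, RingHom.id_apply, ← mul_smul]
        rfl }
  refine ⟨(e : M →ₗ[Aᵐᵒᵖ] S.X₂), ?_⟩
  ext x
  change S.g.hom (MulOpposite.op (l x) • y) = f (MulOpposite.op (l x) • m)
  rw [map_smul, map_smul]
  exact congrArg _ hy

theorem nonempty_ext_liftable_addEquiv (hM : IsGenerator A M) (hS : S.ShortExact)
    [Injective S.X₂] (i : ℕ) :
    Nonempty (ExtGroup (EndRing A M) (StableEnd A M) (liftable M S) i ≃+
      ExtGroup (EndRing A M) (StableEnd A M) (HomFrom A M S.X₁) (i + 1)) := by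
  have : Module.Injective Aᵐᵒᵖ S.X₂ := Module.injective_module_of_injective_object _ _
  let T := ModuleCat.shortComplexOfCompEqZero (HomFrom.map A M S.f.hom)
    (HomFrom.map A M S.g.hom).rangeRestrict (by
      ext h m
      exact congr($(S.zero).hom (h m)))
  have hT : T.ShortExact := by
    refine ModuleCat.shortComplex_shortExact T (fun h => ⟨fun hh => ?_, ?_⟩) ?_
      (LinearMap.surjective_rangeRestrict _)
    · have hex := (ShortComplex.ShortExact.moduleCat_exact_iff_function_exact S).mp hS.exact
      have hh' (m : M) : S.g (h m) = 0 := congr(($hh : liftable M S).1 m)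
      -- The pointwise preimages form a linear map because `S.f` is injective.
      choose k hk using fun m => (hex _).mp (hh' m)
      have hf := hS.moduleCat_injective_f
      let k' : M →ₗ[Aᵐᵒᵖ] S.X₁ :=
        { toFun := k
          map_add' := fun x y => hf (by rw [map_add, hk, hk, hk]; exact map_add h x y)
          map_smul' := fun a x => hf (by
            rw [map_smul, hk, hk]; exact map_smul (show HomFrom A M S.X₂ from h) a x) }
      exact ⟨(k' : M →ₗ[Aᵐᵒᵖ] S.X₁), HomFrom.ext hk⟩
    · rintro ⟨k, rfl⟩
      exact congr($(T.zero).hom k)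
    · intro h h' hh
      exact HomFrom.ext fun m => hS.moduleCat_injective_f congr(($hh : HomFrom A M S.X₂) m)
  exact hT.nonempty_ext_addEquiv _ i (subsingleton_ext_homFrom_of_injective hM _ i)
    (subsingleton_ext_homFrom_of_injective hM _ (i + 1))

theorem subsingleton_ext_zero_liftable (hM : IsGenerator A M) :
    Subsingleton (ExtGroup (EndRing A M) (StableEnd A M) (liftable M S) 0) :=
  subsingleton_ext_zero fun f => LinearMap.ext fun x => Subtype.ext
    (LinearMap.congr_fun (HomFrom.linearMap_eq_zero hM StableEnd.op_normEnd_smul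
      ((liftable M S).subtype ∘ₗ f)) x)

theorem exists_shortExact_injective (N : ModuleCat.{u} Aᵐᵒᵖ) :
    ∃ S : ShortComplex (ModuleCat.{u} Aᵐᵒᵖ), S.ShortExact ∧ Injective S.X₂ ∧ S.X₁ = N :=
  ⟨ShortComplex.mk (Injective.ι N) (Limits.cokernel.π _) (Limits.cokernel.condition _),
    ⟨ShortComplex.exact_cokernel _⟩, inferInstanceAs (Injective (Injective.under N)), rfl⟩

theorem subsingleton_ext_one_homFrom (hM : IsGenerator A M) (N : ModuleCat.{u} Aᵐᵒᵖ) :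
    Subsingleton (ExtGroup (EndRing A M) (StableEnd A M) (HomFrom A M N) 1) := by
  obtain ⟨S, hS, _, rfl⟩ := exists_shortExact_injective N
  obtain ⟨e⟩ := nonempty_ext_liftable_addEquiv hM hS 0
  have := subsingleton_ext_zero_liftable (S := S) hM
  exact e.symm.subsingleton

/-- `Ext¹_A(M, S.X₁)` as the group of maps `M → S.X₃` modulo those that lift to `S.X₂`. -/
theorem nonempty_quotient_liftable_addEquiv (hS : S.ShortExact) [Injective S.X₂] :
    Nonempty ((HomFrom A M S.X₃ ⧸ liftable M S) ≃+ ExtGroup A M S.X₁ 1) := by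
  obtain ⟨δ, hδ, hδ'⟩ := hS.exists_hom_to_ext_one (ModuleCat.of Aᵐᵒᵖ M)
    (Abelian.Ext.subsingleton_of_injective _ _ 0)
  let e : HomFrom A M S.X₃ ≃+ (ModuleCat.of Aᵐᵒᵖ M ⟶ S.X₃) :=
    (ModuleCat.homAddEquiv (M := ModuleCat.of Aᵐᵒᵖ M) (N := S.X₃)).symm
  let ε : HomFrom A M S.X₃ →+ ExtGroup A M S.X₁ 1 := δ.comp e.toAddMonoidHom
  have hε : (liftable M S).toAddSubgroup = ε.ker := by
    ext f
    rw [AddMonoidHom.mem_ker]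
    refine Iff.trans ⟨?_, ?_⟩ (hδ' (e f)).symm
    · rintro ⟨g, rfl⟩
      exact ⟨ModuleCat.ofHom (show M →ₗ[Aᵐᵒᵖ] S.X₂ from g), rfl⟩
    · rintro ⟨g, hg⟩
      exact ⟨g.hom, e.injective hg⟩
  exact ⟨(QuotientAddGroup.quotientAddEquivOfEq hε).trans
    (QuotientAddGroup.quotientKerEquivOfSurjective ε (hδ.comp e.surjective))⟩

theorem nonempty_quotient_liftable_addEquiv_ext_one (hM : IsGenerator A M) (hS : S.ShortExact) :
    Nonempty ((HomFrom A M S.X₃ ⧸ liftable M S) ≃+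
      ExtGroup (EndRing A M) (StableEnd A M) (liftable M S) 1) := by
  let T := ModuleCat.shortComplexOfCompEqZero (liftable M S).subtype (liftable M S).mkQ
    (by ext x; simp)
  have hT : T.ShortExact := ModuleCat.shortComplex_shortExact T
    (LinearMap.exact_subtype_mkQ _) (Submodule.injective_subtype _) (Submodule.mkQ_surjective _)
  -- The middle term `Hom_A(M, S.X₃)` need not be injective; vanishing in degrees 0 and 1, valid for
  -- every module, suffices.
  obtain ⟨e⟩ := hT.nonempty_ext_addEquiv (ModuleCat.of _ (StableEnd A M)) 0
    (subsingleton_ext_zero_homFrom hM _) (subsingleton_ext_one_homFrom hM _)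
  refine ⟨AddEquiv.trans ?_ e⟩
  refine (StableEnd.homEquiv _ fun m l q => ?_).symm.trans
    ((ModuleCat.homAddEquiv (M := ModuleCat.of _ (StableEnd A M)) (N := T.X₃)).symm.trans
      Abelian.Ext.addEquiv₀.symm)
  obtain ⟨f, rfl⟩ := Submodule.mkQ_surjective _ q
  rw [← map_smul]
  exact (Submodule.Quotient.mk_eq_zero _).mpr (normEnd_smul_mem_liftable hS m l f)

end Cosyzygy

theorem nonempty_ext_two_addEquiv (hM : IsGenerator A M) (N : ModuleCat.{u} Aᵐᵒᵖ) :
    Nonempty (ExtGroup (EndRing A M) (StableEnd A M) (HomFrom A M N) 2 ≃+ ExtGroup A M N 1) := by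
  obtain ⟨S, hS, _, rfl⟩ := exists_shortExact_injective N
  obtain ⟨e₁⟩ := nonempty_ext_liftable_addEquiv hM hS 1
  obtain ⟨e₂⟩ := nonempty_quotient_liftable_addEquiv (M := M) hS
  obtain ⟨e₃⟩ := nonempty_quotient_liftable_addEquiv_ext_one hM hS
  exact ⟨e₁.symm.trans (e₃.symm.trans e₂)⟩

/-- If `Ext^i_A(M, N)` vanishes for `1 ≤ i ≤ n`, then `Ext^i` over `End_A(M)` from the stable
endomorphism ring to `Hom_A(M, N)` vanishes for `i ≤ n + 1`, and in degree `n + 2` it is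
`Ext^{n+1}_A(M, N)`. -/
theorem ext_stableEnd_homFrom (hM : IsGenerator A M) (n : ℕ) (N : ModuleCat.{u} Aᵐᵒᵖ)
    (h : ∀ i, 1 ≤ i → i ≤ n → Subsingleton (ExtGroup A M N i)) :
    (∀ i ≤ n + 1,
      Subsingleton (ExtGroup (EndRing A M) (StableEnd A M) (HomFrom A M N) i)) ∧
    Nonempty (ExtGroup (EndRing A M) (StableEnd A M) (HomFrom A M N) (n + 2) ≃+
      ExtGroup A M N (n + 1)) := by
  induction n generalizing N with
  | zero =>
    refine ⟨fun i hi => ?_, nonempty_ext_two_addEquiv hM N⟩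
    interval_cases i
    · exact subsingleton_ext_zero_homFrom hM N
    · exact subsingleton_ext_one_homFrom hM N
  | succ n ih =>
    obtain ⟨S, hS, hJ, rfl⟩ := exists_shortExact_injective N
    have shift (i : ℕ) : Nonempty (ExtGroup A M S.X₃ (i + 1) ≃+ ExtGroup A M S.X₁ (i + 2)) :=
      hS.nonempty_ext_addEquiv _ (i + 1) (Abelian.Ext.subsingleton_of_injective _ _ i)
        (Abelian.Ext.subsingleton_of_injective _ _ (i + 1))
    obtain ⟨e₁⟩ := nonempty_quotient_liftable_addEquiv (M := M) hS
    have hsub := h 1 le_rfl (by omega)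
    -- Vanishing of `Ext¹_A(M, S.X₁)` makes every map to `S.X₃` lift, so the cokernel over `B` is
    -- again of the form `Hom_A(M, -)` and the induction hypothesis applies to `S.X₃`.
    have htop : liftable M S = ⊤ := Submodule.Quotient.subsingleton_iff.mp e₁.subsingleton
    have shift' (i : ℕ) : Nonempty
        (ExtGroup (EndRing A M) (StableEnd A M) (HomFrom A M S.X₃) i ≃+
          ExtGroup (EndRing A M) (StableEnd A M) (HomFrom A M S.X₁) (i + 1)) := by
      obtain ⟨e⟩ := nonempty_ext_liftable_addEquiv hM hS i
      let t : ModuleCat.of _ (HomFrom A M S.X₃) ≅ ModuleCat.of _ (liftable M S) :=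
        ((LinearEquiv.ofTop _ htop).symm).toModuleIso
      exact ⟨((Abelian.extFunctorObj _ i).mapIso t).addCommGroupIsoToAddEquiv.trans e⟩
    obtain ⟨h₁, ⟨e₂⟩⟩ := ih S.X₃ fun i hi hin => by
      obtain ⟨i, rfl⟩ := Nat.exists_eq_add_of_le' hi
      obtain ⟨e⟩ := shift i
      have := h (i + 2) (by omega) (by omega)
      exact e.subsingleton
    refine ⟨fun i hi => ?_, ?_⟩
    · cases i with
      | zero => exact subsingleton_ext_zero_homFrom hM _
      | succ i =>
        obtain ⟨e⟩ := shift' i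
        have := h₁ i (by omega)
        exact e.symm.subsingleton
    · obtain ⟨e⟩ := shift' (n + 2)
      obtain ⟨e'⟩ := shift n
      exact ⟨e.symm.trans (e₂.trans e')⟩

theorem ext_stableEnd (hM : IsGenerator A M) (n : ℕ)
    (h : ∀ i, 1 ≤ i → i ≤ n → Subsingleton (ExtGroup A M M i)) :
    (∀ i ≤ n + 1, Subsingleton (ExtGroup (EndRing A M) (StableEnd A M) (EndRing A M) i)) ∧
    Nonempty (ExtGroup (EndRing A M) (StableEnd A M) (EndRing A M) (n + 2) ≃+
      ExtGroup A M M (n + 1)) := by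
  have t (i : ℕ) : ExtGroup (EndRing A M) (StableEnd A M) (EndRing A M) i ≃+
      ExtGroup (EndRing A M) (StableEnd A M) (HomFrom A M M) i :=
    ((Abelian.extFunctorObj _ i).mapIso
      (HomFrom.endEquiv A M).toModuleIso).addCommGroupIsoToAddEquiv
  obtain ⟨h₁, ⟨e⟩⟩ := ext_stableEnd_homFrom hM n (ModuleCat.of _ M) h
  exact ⟨fun i hi => have := h₁ i hi; (t i).subsingleton, ⟨(t _).trans e⟩⟩

end RightModule

/-! ### The grade formula -/

theorem theorem2 (A : Type u) [Ring A] (M : Type u) [AddCommGroup M] [Module Aᵐᵒᵖ M]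
    (hM : RightModule.IsGenerator A M) :
    RightModule.grade (RightModule.EndRing A M) (RightModule.StableEnd A M) =
        1 + (⨅ (i : ℕ) (_ : 1 ≤ i ∧ Nontrivial (RightModule.ExtGroup A M M i)), (i : ℕ∞)) ∧
      2 ≤ RightModule.grade (RightModule.EndRing A M) (RightModule.StableEnd A M) ∧
      ∀ g : ℕ,
        RightModule.grade (RightModule.EndRing A M) (RightModule.StableEnd A M) = (g : ℕ∞) →
        Nonempty
          (RightModule.ExtGroup (RightModule.EndRing A M) (RightModule.StableEnd A M)
              (RightModule.EndRing A M) g ≃+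
            RightModule.ExtGroup A M M (g - 1)) := by
  classical
  -- With the shift `n + 1`, the least such `n` gives the first positive degree of nonvanishing, and
  -- the grade is `n + 2`.
  by_cases hex : ∃ n, Nontrivial (RightModule.ExtGroup A M M (n + 1))
  · have hn := Nat.find_spec hex
    have hmin (m : ℕ) (hm : m < Nat.find hex) := Nat.find_min hex hm
    generalize Nat.find hex = n at hn hmin
    obtain ⟨hlow, ⟨e⟩⟩ := RightModule.ext_stableEnd hM n fun i hi hin => by
      obtain ⟨i, rfl⟩ := Nat.exists_eq_add_of_le' hi
      exact not_nontrivial_iff_subsingleton.mp (hmin i (by omega))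
    have hinf : (⨅ (i : ℕ) (_ : 1 ≤ i ∧ Nontrivial (RightModule.ExtGroup A M M i)), (i : ℕ∞)) =
        (n + 1 : ℕ) := by
      refine le_antisymm (iInf₂_le _ ⟨by omega, hn⟩) (le_iInf₂ fun i hi => ?_)
      obtain ⟨i, rfl⟩ := Nat.exists_eq_add_of_le' hi.1
      have : n ≤ i := not_lt.mp fun hlt => hmin i hlt hi.2
      exact_mod_cast Nat.succ_le_succ this
    have hgrade : RightModule.grade (RightModule.EndRing A M) (RightModule.StableEnd A M) =
        (n + 2 : ℕ) := by
      refine le_antisymm (iInf₂_le (n + 2) e.toEquiv.nontrivial) (le_iInf₂ fun i hi => ?_)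
      have : n + 2 ≤ i := not_lt.mp fun hlt =>
        not_nontrivial_iff_subsingleton.mpr (hlow i (by omega)) hi
      exact_mod_cast this
    rw [hgrade, hinf]
    refine ⟨?_, ?_, fun g hg => ?_⟩
    · norm_cast
      omega
    · norm_cast
      omega
    · obtain rfl : n + 2 = g := by exact_mod_cast hg
      exact ⟨e⟩
  · have hsub (i : ℕ) (hi : 1 ≤ i) : Subsingleton (RightModule.ExtGroup A M M i) := by
      obtain ⟨i, rfl⟩ := Nat.exists_eq_add_of_le' hi
      exact not_nontrivial_iff_subsingleton.mp fun h => hex ⟨i, h⟩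
    have hgrade : RightModule.grade (RightModule.EndRing A M) (RightModule.StableEnd A M) = ⊤ :=
      iInf₂_eq_top.mpr fun i hi => absurd hi <| not_nontrivial_iff_subsingleton.mpr <|
        -- With no positive self-extensions, the vanishing range can be taken to reach any degree
        -- `i`.
        (RightModule.ext_stableEnd hM i fun j hj _ => hsub j hj).1 i (by omega)
    have hinf : (⨅ (i : ℕ) (_ : 1 ≤ i ∧ Nontrivial (RightModule.ExtGroup A M M i)), (i : ℕ∞)) =
        ⊤ :=
      iInf₂_eq_top.mpr fun i hi => absurd hi.2 <| not_nontrivial_iff_subsingleton.mpr (hsub i hi.1)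
    rw [hgrade, hinf]
    exact ⟨rfl, le_top, fun g hg => absurd hg.symm (ENat.natCast_ne_top g)⟩
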